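/- Let $f(z)=\sum_{\alpha\in A}a_\alpha z^\alpha$ be a complex Laurent polynomial in $n$ variables, with $A\subset\mathbb{Z}^n$ finite and $a_\alpha\in\mathbb{C}\setminus\{0\}$, and let $\Delta_f\subset\mathbb{R}^n$ be its Newton polytope, the convex hull of $A$. For $z\in(\mathbb{C}\setminus\{0\})^n$ let $\operatorname{Arg}(z)=(\arg z_1,\ldots,\arg z_n)$ be the multivalued argument, with values in $\mathbb{R}^n$, and let the coamoeba $\mathcal{A}'_f\subset\mathbb{R}^n$ be the ($2\pi$-periodic) set of all values of $\operatorname{Arg}(z)$ at points $z\in(\mathbb{C}\setminus\{0\})^n$ with $f(z)=0$. Let $E$ be a connected component of $\mathbb{R}^n\setminus\overline{\mathcal{A}'_f}$. Then the following hold. (i) For every $\theta\in E$ and every $s\in\mathbb{C}^n$ with $\operatorname{Re}s\in\operatorname{int}\Delta_f$, the integral $$M^E_{1/f}(s)=\frac{1}{(2\pi i)^n}\int_{\operatorname{Arg}^{-1}(\theta)}\frac{z^s}{f(z)}\frac{dz}{z}=\frac{1}{(2\pi i)^n}\int_{\mathbb{R}^n}\frac{e^{\langle s,x+i\theta\rangle}}{f(e^{x+i\theta})}\,dx$$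 converges absolutely, and its value does not depend on the choice of $\theta\in E$. (ii) For every $\sigma\in\operatorname{int}\Delta_f$ and every $z\in\operatorname{Arg}^{-1}(E)$, that is, every $z\in(\mathbb{C}\setminus\{0\})^n$ for which some value $\varphi$ of $\operatorname{Arg}(z)$ lies in $E$, one has $f(z)\neq0$ and $$\frac{1}{f(z)}=\int_{\sigma+i\mathbb{R}^n}M^E_{1/f}(s)\,z^{-s}\,ds,$$ where the integral converges absolutely, $z^{-s}=\exp\bigl(-\sum_k s_k(\log|z_k|+i\varphi_k)\bigr)$, and $ds=ds_1\wedge\cdots\wedge ds_n=i^n\,dt$ for $s=\sigma+it$. -/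

import Mathlib

open MeasureTheory

noncomputable section

/-- Complex Laurent polynomials in `n` variables: finitely supported families of complex
coefficients indexed by the exponents `α ∈ ℤⁿ`. The set of exponents that occur (with nonzero
coefficient) is the support. -/
abbrev LaurentPoly (n : ℕ) : Type := AddMonoidAlgebra ℂ (Fin n → ℤ)

namespace LaurentPoly

variable {n : ℕ}

/-- The value `f(z) = ∑ a_α z^α`, where `z^α = z₁^α₁ ⋯ zₙ^αₙ`. -/
def eval (f : LaurentPoly n) (z : Fin n → ℂ) : ℂ :=
  ∑ α ∈ f.coeff.support, f.coeff α * ∏ k, z k ^ α k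

/-- The Newton polytope: the convex hull in `ℝⁿ` of the exponents that occur in `f`. -/
def newtonPolytope (f : LaurentPoly n) : Set (Fin n → ℝ) :=
  convexHull ℝ ((fun (α : Fin n → ℤ) (k : Fin n) => (α k : ℝ)) '' (f.coeff.support : Set (Fin n → ℤ)))

end LaurentPoly

/-- `z` is a point of the complex torus `(ℂ∖{0})ⁿ`, and `θ ∈ ℝⁿ` is one of the values of the
(multivalued) coordinatewise argument `Arg z`. -/
def IsArg {n : ℕ} (z : Fin n → ℂ) (θ : Fin n → ℝ) : Prop :=
  ∀ k, z k ≠ 0 ∧ z k = (‖z k‖ : ℂ) * Complex.exp (Complex.I * (θ k : ℂ))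

/-- The coamoeba of `f`, the image under `Arg` of the zero set of `f` in `(ℂ∖{0})ⁿ`, as a
`2π`-periodic subset of `ℝⁿ`. -/
def LaurentPoly.coamoeba {n : ℕ} (f : LaurentPoly n) : Set (Fin n → ℝ) :=
  {θ | ∃ z : Fin n → ℂ, f.eval z = 0 ∧ IsArg z θ}

/-- The connected components of the complement of the closure of the coamoeba. -/
def LaurentPoly.IsCoamoebaComplementComponent {n : ℕ} (f : LaurentPoly n)
    (E : Set (Fin n → ℝ)) : Prop :=
  ∃ θ ∈ (closure f.coamoeba)ᶜ, E = connectedComponentIn (closure f.coamoeba)ᶜ θ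

/-- The power `z^s = exp ⟨s, log z⟩`, with the branch `log z_k = log |z_k| + i θ_k`. -/
def cpowBranch {n : ℕ} (θ : Fin n → ℝ) (z s : Fin n → ℂ) : ℂ :=
  Complex.exp (∑ k, s k * ((Real.log ‖z k‖ : ℂ) + Complex.I * (θ k : ℂ)))

/-- The integrand `e^{⟨s, x + iθ⟩} / f(e^{x + iθ})` of the directional Mellin transform. -/
def LaurentPoly.mellinIntegrand {n : ℕ} (f : LaurentPoly n) (θ : Fin n → ℝ) (s : Fin n → ℂ)
    (x : Fin n → ℝ) : ℂ :=
  Complex.exp (∑ k, s k * ((x k : ℂ) + Complex.I * (θ k : ℂ))) /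
    f.eval (fun k => Complex.exp ((x k : ℂ) + Complex.I * (θ k : ℂ)))

/-- The normalized directional Mellin transform of `1/f`,
`(2πi)⁻ⁿ ∫_{Arg⁻¹(θ)} z^s / f(z) dz/z = (2πi)⁻ⁿ ∫_{ℝⁿ} e^{⟨s, x + iθ⟩} / f(e^{x + iθ}) dx`. -/
def LaurentPoly.directionalMellin {n : ℕ} (f : LaurentPoly n) (θ : Fin n → ℝ)
    (s : Fin n → ℂ) : ℂ :=
  1 / (2 * (Real.pi : ℂ) * Complex.I) ^ n * ∫ x : Fin n → ℝ, f.mellinIntegrand θ s x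

/-- The point `σ + it` of the vertical `n`-plane `σ + iℝⁿ`. -/
def verticalPoint {n : ℕ} (σ t : Fin n → ℝ) : Fin n → ℂ :=
  fun k => (σ k : ℂ) + Complex.I * (t k : ℂ)

/-- Absolute convergence of `∫_{σ + iℝⁿ} g(s) ds`. -/
def VerticalIntegrable {n : ℕ} (g : (Fin n → ℂ) → ℂ) (σ : Fin n → ℝ) : Prop :=
  Integrable (fun t : Fin n → ℝ => g (verticalPoint σ t)) volume

/-- `∫_{σ + iℝⁿ} g(s) ds`, where `ds = ds₁ ∧ ⋯ ∧ dsₙ = iⁿ dt` for `s = σ + it`. -/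
def verticalIntegral {n : ℕ} (g : (Fin n → ℂ) → ℂ) (σ : Fin n → ℝ) : ℂ :=
  Complex.I ^ n * ∫ t : Fin n → ℝ, g (verticalPoint σ t)

end

/-! Write `z = exp w`. Everything rests on one lower bound: for `Im w` near a point off the closed
coamoeba, `|f(e^w)|` dominates `e^{⟨y, Re w⟩}` for all `y` in the Newton polytope
(`exists_exp_le_mul_norm_eval`). Restricted to a complex line in a real direction separating the
exponents, `f` is a one-variable exponential sum without zeros in a disc of fixed radius; Hurwitz's
theorem and compactness of the coefficient sphere bound its value at the centre below by its largest
term.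

For `Re s` interior to the polytope, moving `y` around `Re s` makes the Mellin integrand decay
exponentially. Shifting the contour in a tube (`integral_tube_eq`) shows that the transform is
locally constant in `θ`, hence constant on the connected set `E`.

On `σ + iℝⁿ` the transform is, up to an exponential factor, the Fourier transform of the integrand
at `s = σ`. The freedom to move `θ` in every direction makes that Fourier transform decay
exponentially, so Fourier inversion applies and gives the formula for `1/f`. -/

/-! ### Exponential sums without zeros in a disc -/

/-- Exponentials with distinct real frequencies are linearly independent. -/
theorem eq_zero_of_sum_mul_exp_eq_zero {ι : Type*} [Fintype ι] {l : ι → ℝ}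
    (hl : Function.Injective l) {u : ι → ℂ}
    (h : ∀ τ : ℂ, ∑ i, u i * Complex.exp (l i * τ) = 0) : u = 0 := by
  -- Each exponential is a character of the additive group `ℂ`, so Dedekind's independence of
  -- characters applies.
  let χ : ι → (Multiplicative ℂ →* ℂ) := fun i =>
    { toFun := fun τ => Complex.exp (l i * τ.toAdd)
      map_one' := by simp
      map_mul' := fun a b => by simp [mul_add, Complex.exp_add] }
  have hχ : Function.Injective χ := by
    intro i j hij
    have h1 : Complex.exp (l i * 1) = Complex.exp (l j * 1) :=
      DFunLike.congr_fun hij (Multiplicative.ofAdd (1 : ℂ))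
    rw [mul_one, mul_one, ← Complex.ofReal_exp, ← Complex.ofReal_exp] at h1
    exact hl (Real.exp_injective (Complex.ofReal_injective h1))
  have hli := (linearIndependent_monoidHom (Multiplicative ℂ) ℂ).comp χ hχ
  rw [Fintype.linearIndependent_iff] at hli
  funext i
  refine hli u ?_ i
  funext τ
  simpa [χ, Finset.sum_apply] using h τ.toAdd

theorem differentiable_sum_mul_exp {ι : Type*} [Fintype ι] (l : ι → ℝ) (u : ι → ℂ) :
    Differentiable ℂ fun τ : ℂ => ∑ i, u i * Complex.exp (l i * τ) := by
  fun_prop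

/-- A nonzero exponential sum is not identically zero, so its zeros are isolated. The resulting
zero-free circle is what Hurwitz's theorem needs. -/
theorem exists_radius_sum_mul_exp_ne_zero {ι : Type*} [Fintype ι] {l : ι → ℝ}
    (hl : Function.Injective l) {u : ι → ℂ} (hu : u ≠ 0) {r : ℝ} (hr : 0 < r) :
    ∃ ρ, 0 < ρ ∧ ρ < r ∧ ∀ τ ∈ Metric.sphere (0 : ℂ) ρ,
      ∑ i, u i * Complex.exp (l i * τ) ≠ 0 := by
  set g : ℂ → ℂ := fun τ => ∑ i, u i * Complex.exp (l i * τ) with hg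
  have hd : Differentiable ℂ g := differentiable_sum_mul_exp l u
  have han : AnalyticOnNhd ℂ g Set.univ := fun z _ => hd.analyticAt z
  rcases (han 0 trivial).eventually_eq_zero_or_eventually_ne_zero with h0 | h0
  · exfalso
    apply hu
    apply eq_zero_of_sum_mul_exp_eq_zero hl
    intro τ
    exact han.eqOn_zero_of_preconnected_of_eventuallyEq_zero isPreconnected_univ trivial h0
      (Set.mem_univ τ)
  · rw [eventually_nhdsWithin_iff, Metric.eventually_nhds_iff] at h0
    obtain ⟨η, hη, h0⟩ := h0
    have hm : 0 < min η r := lt_min hη hr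
    refine ⟨min η r / 2, by positivity, by linarith [min_le_right η r], fun τ hτ => ?_⟩
    rw [mem_sphere_zero_iff_norm] at hτ
    refine h0 ?_ ?_
    · rw [dist_zero_right, hτ]; linarith [min_le_left η r]
    · intro h
      rw [Set.mem_singleton_iff] at h
      rw [h, norm_zero] at hτ
      linarith

/-- Hurwitz's theorem for a continuous family of entire functions: a limit of functions without
zeros in a disc has no zero at the centre, if it has none on some smaller circle. -/
theorem ne_zero_of_mem_closure_of_forall_ne_zero {X : Type*} [TopologicalSpace X] {F : X → ℂ → ℂ}
    (hF : Continuous fun p : X × ℂ => F p.1 p.2) (hd : ∀ x, Differentiable ℂ (F x)) {ρ : ℝ}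
    (hρ : 0 < ρ) {Z : Set X} (hZ : ∀ x ∈ Z, ∀ τ ∈ Metric.closedBall (0 : ℂ) ρ, F x τ ≠ 0)
    {u : X} (hu : u ∈ closure Z) (hne : ∀ τ ∈ Metric.sphere (0 : ℂ) ρ, F u τ ≠ 0) :
    F u 0 ≠ 0 := by
  intro h0
  have hSne : (Metric.sphere (0 : ℂ) ρ).Nonempty := NormedSpace.sphere_nonempty.2 hρ.le
  obtain ⟨τ₀, hτ₀, hmin⟩ := (isCompact_sphere (0 : ℂ) ρ).exists_isMinOn hSne
    (hd u).continuous.norm.continuousOn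
  obtain ⟨m, hm⟩ : ∃ m, m = ‖F u τ₀‖ := ⟨_, rfl⟩
  have hmpos : 0 < m := hm ▸ norm_pos_iff.2 (hne τ₀ hτ₀)
  have h1 : ∀ᶠ w in nhds u, ∀ τ ∈ Metric.sphere (0 : ℂ) ρ, m / 2 < ‖F w τ‖ := by
    refine (isCompact_sphere (0 : ℂ) ρ).eventually_forall_of_forall_eventually
      (P := fun w τ => m / 2 < ‖F w τ‖) fun τ hτ => ?_
    have hlt : m / 2 < ‖F u τ‖ := (half_lt_self hmpos).trans_le (hm ▸ hmin hτ)
    exact (isOpen_lt continuous_const hF.norm).mem_nhds hlt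
  have h2 : ∀ᶠ w in nhds u, ‖F w 0‖ < m / 2 := by
    have hc : Continuous fun w => ‖F w 0‖ :=
      (hF.comp (continuous_id.prodMk continuous_const)).norm
    refine (isOpen_lt hc continuous_const).mem_nhds ?_
    show ‖F u 0‖ < m / 2
    rw [h0, norm_zero]
    positivity
  obtain ⟨w, ⟨hw1, hw2⟩, hwZ⟩ := mem_closure_iff_nhds.1 hu _ (h1.and h2)
  -- Maximum principle for `1 / F w`: at the centre it would exceed `2 / m`, while on the circle it
  -- stays below.
  have hdiff : DiffContOnCl ℂ (fun τ : ℂ => (F w τ)⁻¹) (Metric.ball 0 ρ) := by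
    refine DifferentiableOn.diffContOnCl ?_
    rw [closure_ball _ hρ.ne']
    exact (hd w).differentiableOn.inv (hZ w hwZ)
  have hmax := Complex.norm_le_of_forall_mem_frontier_norm_le Metric.isBounded_ball hdiff
    (C := (m / 2)⁻¹) (z := 0) ?_ (subset_closure (Metric.mem_ball_self hρ))
  · rw [norm_inv] at hmax
    have hpos : 0 < ‖F w 0‖ := norm_pos_iff.2 (hZ w hwZ 0 (Metric.mem_closedBall_self hρ.le))
    exact absurd ((inv_le_inv₀ hpos (by positivity)).1 hmax) (not_le.2 hw2)
  · intro τ hτ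
    rw [frontier_ball _ hρ.ne'] at hτ
    rw [norm_inv]
    exact inv_anti₀ (by positivity) (hw1 τ hτ).le

/-- A minimum-modulus form of Hurwitz's theorem: an exponential sum without zeros in a disc is
bounded below at the centre in terms of the size of its coefficients. -/
theorem exists_mul_norm_le_norm_sum {ι : Type*} [Fintype ι] {l : ι → ℝ}
    (hl : Function.Injective l) {r : ℝ} (hr : 0 < r) :
    ∃ c > 0, ∀ u : ι → ℂ,
      (∀ τ ∈ Metric.ball (0 : ℂ) r, ∑ i, u i * Complex.exp (l i * τ) ≠ 0) →
      c * ‖u‖ ≤ ‖∑ i, u i‖ := by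
  -- By homogeneity, unit coefficient vectors suffice. `Z` need not be closed; Hurwitz shows that
  -- the sum at `τ = 0` stays nonzero on its compact closure, so its modulus has a positive minimum
  -- there.
  set Z : Set (ι → ℂ) := {u | u ∈ Metric.sphere (0 : ι → ℂ) 1 ∧
    ∀ τ ∈ Metric.ball (0 : ℂ) r, ∑ i, u i * Complex.exp (l i * τ) ≠ 0} with hZ
  have hZs : closure Z ⊆ Metric.sphere 0 1 :=
    closure_minimal (fun u hu => hu.1) Metric.isClosed_sphere
  have hZc : IsCompact (closure Z) :=
    (isCompact_sphere (0 : ι → ℂ) 1).of_isClosed_subset isClosed_closure hZs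
  have hne : ∀ u ∈ closure Z, ∑ i, u i ≠ 0 := by
    intro u hu hsum
    have hu0 : u ≠ 0 := by
      rintro rfl
      have := hZs hu
      simp at this
    obtain ⟨ρ, hρ, hρr, hne⟩ := exists_radius_sum_mul_exp_ne_zero hl hu0 hr
    refine ne_zero_of_mem_closure_of_forall_ne_zero
      (F := fun (w : ι → ℂ) τ => ∑ i, w i * Complex.exp (l i * τ)) (by fun_prop)
      (differentiable_sum_mul_exp l) hρ
      (fun w hw τ hτ => hw.2 τ (Metric.closedBall_subset_ball hρr hτ)) hu hne ?_
    simpa using hsum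
  have hscale : ∀ c > 0, (∀ u ∈ Z, c ≤ ‖∑ i, u i‖) → ∀ u : ι → ℂ,
      (∀ τ ∈ Metric.ball (0 : ℂ) r, ∑ i, u i * Complex.exp (l i * τ) ≠ 0) →
      c * ‖u‖ ≤ ‖∑ i, u i‖ := by
    intro c hc hcZ u hu
    rcases eq_or_ne u 0 with rfl | hu0
    · simp
    have hpos : 0 < ‖u‖ := norm_pos_iff.2 hu0
    have hcast : ((‖u‖⁻¹ : ℝ) : ℂ) ≠ 0 := by
      exact_mod_cast (inv_pos.2 hpos).ne'
    have hmem : (((‖u‖⁻¹ : ℝ) : ℂ) • u) ∈ Z := by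
      refine ⟨?_, fun τ hτ => ?_⟩
      · rw [mem_sphere_zero_iff_norm, norm_smul, Complex.norm_real, norm_inv, norm_norm,
          inv_mul_cancel₀ hpos.ne']
      · have := mul_ne_zero hcast (hu τ hτ)
        rw [Finset.mul_sum] at this
        simpa only [Pi.smul_apply, smul_eq_mul, mul_assoc] using this
    have h := hcZ _ hmem
    simp only [Pi.smul_apply, smul_eq_mul] at h
    rw [← Finset.mul_sum, norm_mul, Complex.norm_real, norm_inv, norm_norm,
      inv_mul_eq_div, le_div_iff₀ hpos] at h
    exact h
  rcases (closure Z).eq_empty_or_nonempty with hE | hN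
  · refine ⟨1, one_pos, hscale 1 one_pos fun u hu => ?_⟩
    have := subset_closure hu
    rw [hE] at this
    exact this.elim
  · obtain ⟨u₀, hu₀, hmin⟩ := hZc.exists_isMinOn hN
      (f := fun u : ι → ℂ => ‖∑ i, u i‖) (by fun_prop)
    exact ⟨_, norm_pos_iff.2 (hne u₀ hu₀), hscale _ (norm_pos_iff.2 (hne u₀ hu₀))
      fun u hu => hmin (subset_closure hu)⟩

/-! ### Shifting integrals inside a tube -/

theorem integrable_exp_neg_mul_abs {ε : ℝ} (hε : 0 < ε) :
    Integrable fun x : ℝ => Real.exp (-ε * |x|) := by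
  rw [← integrableOn_univ, ← Set.Iic_union_Ioi (a := (0 : ℝ)), integrableOn_union]
  constructor
  · refine (integrableOn_exp_mul_Iic hε 0).congr_fun (fun x hx => ?_) measurableSet_Iic
    simp only [abs_of_nonpos (Set.mem_Iic.1 hx)]
    ring_nf
  · refine (integrableOn_exp_mul_Ioi (neg_lt_zero.2 hε) 0).congr_fun (fun x hx => ?_)
      measurableSet_Ioi
    simp only [abs_of_pos (Set.mem_Ioi.1 hx)]

theorem integrable_exp_neg_mul_sum_abs {n : ℕ} {ε : ℝ} (hε : 0 < ε) :
    Integrable fun x : Fin n → ℝ => Real.exp (-ε * ∑ k, |x k|) := by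
  have := Integrable.fintype_prod (ι := Fin n) (E := ℝ) (𝕜 := ℝ)
    (f := fun _ x => Real.exp (-ε * |x|)) (μ := fun _ => volume)
    fun _ => integrable_exp_neg_mul_abs hε
  simp only [← Real.exp_sum, ← Finset.mul_sum] at this
  exact this

/-- The integral over `ℝⁿ + iθ` of a holomorphic function on a convex tube with exponential decay
does not depend on `θ`. -/
theorem integral_tube_eq {n : ℕ} {G : (Fin n → ℂ) → ℂ} {U : Set (Fin n → ℝ)} (hU : IsOpen U)
    (hconv : Convex ℝ U) {ε C : ℝ} (hε : 0 < ε) (hC : 0 ≤ C)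
    (hG : ∀ w : Fin n → ℂ, (fun k => (w k).im) ∈ U → DifferentiableAt ℂ G w)
    (hb : ∀ w : Fin n → ℂ, (fun k => (w k).im) ∈ U →
      ‖G w‖ ≤ C * Real.exp (-ε * ∑ k, |(w k).re|))
    {θ θ' : Fin n → ℝ} (hθ : θ ∈ U) (hθ' : θ' ∈ U) :
    ∫ x : Fin n → ℝ, G (fun k => (x k : ℂ) + Complex.I * (θ k : ℂ)) =
      ∫ x : Fin n → ℝ, G (fun k => (x k : ℂ) + Complex.I * (θ' k : ℂ)) := by
  set v : Fin n → ℝ := θ' - θ with hv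
  set vc : Fin n → ℂ := fun k => (v k : ℂ) with hvc
  -- One complex parameter joins the two contours: `ζ = 0` gives `θ` and `ζ = I` gives `θ'`.
  set p : ℂ → (Fin n → ℝ) → (Fin n → ℂ) := fun ζ x =>
    (fun k => (x k : ℂ) + Complex.I * (θ k : ℂ)) + ζ • vc with hp
  have hpim : ∀ ζ x, (fun k => (p ζ x k).im) = θ + ζ.im • v := by
    intro ζ x; funext k; simp [hp, hvc]
  have hpre : ∀ ζ x k, (p ζ x k).re = x k + ζ.re * v k := by
    intro ζ x k; simp [hp, hvc]
  set S : Set ℂ := {ζ | θ + ζ.im • v ∈ U} with hS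
  have hSo : IsOpen S := hU.preimage (by fun_prop : Continuous fun ζ : ℂ => θ + ζ.im • v)
  have hSc : Convex ℝ S := by
    intro a ha b hb s t hs ht hst
    have := hconv ha hb hs ht hst
    simp only [hS, Set.mem_ofPred_eq]
    convert this using 1
    funext k
    simp only [Pi.add_apply, Pi.smul_apply, smul_eq_mul, Complex.add_im, Complex.real_smul,
      Complex.mul_im, Complex.ofReal_re, Complex.ofReal_im, zero_mul, add_zero]
    linear_combination (-θ k) * hst
  have hpS : ∀ ζ ∈ S, ∀ x, (fun k => (p ζ x k).im) ∈ U := fun ζ hζ x => by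
    rw [hpim]; exact hζ
  have hpc : ∀ ζ, Continuous (p ζ) := fun ζ => by fun_prop
  have hcont : ∀ ζ ∈ S, Continuous fun x => G (p ζ x) := fun ζ hζ =>
    continuous_iff_continuousAt.2 fun x =>
      ContinuousAt.comp (f := p ζ) (hG _ (hpS ζ hζ x)).continuousAt (hpc ζ).continuousAt
  have hder : ∀ ζ ∈ S, ∀ x, HasDerivAt (fun ζ => G (p ζ x)) (fderiv ℂ G (p ζ x) vc) ζ := by
    intro ζ hζ x
    have h1 : HasDerivAt (fun ζ => p ζ x) vc ζ := by
      have h2 := ((hasDerivAt_id ζ).smul_const vc).const_add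
        (fun k => (x k : ℂ) + Complex.I * (θ k : ℂ))
      rw [one_smul] at h2
      exact h2
    exact (hG _ (hpS ζ hζ x)).hasFDerivAt.comp_hasDerivAt ζ h1
  have hbound : ∀ M : ℝ, ∀ ζ ∈ S, ‖ζ‖ ≤ M → ∀ x, ‖G (p ζ x)‖ ≤
      (C * Real.exp (ε * ∑ k, M * |v k|)) * Real.exp (-ε * ∑ k, |x k|) := by
    intro M ζ hζ hM x
    refine (hb _ (hpS ζ hζ x)).trans ?_
    rw [mul_assoc, ← Real.exp_add]
    refine mul_le_mul_of_nonneg_left (Real.exp_le_exp.2 ?_) hC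
    have : ∑ k, |x k| ≤ ∑ k, M * |v k| + ∑ k, |(p ζ x k).re| := by
      rw [← Finset.sum_add_distrib]
      refine Finset.sum_le_sum fun k _ => ?_
      rw [hpre]
      have h1 : |x k| ≤ |x k + ζ.re * v k| + |ζ.re * v k| := by
        simpa using abs_sub (x k + ζ.re * v k) (ζ.re * v k)
      have h2 : |ζ.re * v k| ≤ M * |v k| := by
        rw [abs_mul]
        exact mul_le_mul_of_nonneg_right ((Complex.abs_re_le_norm ζ).trans hM) (abs_nonneg _)
      linarith
    nlinarith
  have hint : ∀ ζ ∈ S, Integrable fun x => G (p ζ x) := fun ζ hζ =>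
    ((integrable_exp_neg_mul_sum_abs hε).const_mul _).mono' (hcont ζ hζ).aestronglyMeasurable
      (Filter.Eventually.of_forall (hbound ‖ζ‖ ζ hζ le_rfl))
  have hH : ∀ ζ ∈ S, HasDerivAt (fun ζ => ∫ x, G (p ζ x)) (∫ x, fderiv ℂ G (p ζ x) vc) ζ := by
    intro ζ₀ hζ₀
    obtain ⟨R, hR, hRS⟩ := Metric.nhds_basis_closedBall.mem_iff.1 (hSo.mem_nhds hζ₀)
    have hR2 : 0 < R / 2 := by positivity
    refine (hasDerivAt_integral_of_dominated_loc_of_deriv_le (𝕜 := ℂ)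
      (F' := fun ζ x => fderiv ℂ G (p ζ x) vc) (s := Metric.ball ζ₀ (R / 2))
      (bound := fun x => (C * Real.exp (ε * ∑ k, (‖ζ₀‖ + R) * |v k|)) *
        Real.exp (-ε * ∑ k, |x k|) / (R / 2))
      (Metric.ball_mem_nhds _ hR2) ?_ (hint ζ₀ hζ₀) ?_ ?_ ?_ ?_).2
    · filter_upwards [hSo.mem_nhds hζ₀] with ζ hζ using (hcont ζ hζ).aestronglyMeasurable
    · exact ((measurable_fderiv_apply_const ℂ G vc).comp
        (hpc ζ₀).measurable).aestronglyMeasurable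
    · refine Filter.Eventually.of_forall fun x ζ hζ => ?_
      have hsub : Metric.closedBall ζ (R / 2) ⊆ Metric.closedBall ζ₀ R := by
        refine Metric.closedBall_subset_closedBall' ?_
        have := Metric.mem_ball.1 hζ
        linarith
      have hζS : ζ ∈ S := hRS (hsub (Metric.mem_closedBall_self hR2.le))
      rw [← (hder ζ hζS x).deriv]
      -- Cauchy's estimate on a circle of radius `R / 2` turns the bound on `G` into an integrable
      -- bound on its derivative.
      refine Complex.norm_deriv_le_of_forall_mem_sphere_norm_le hR2 ?_ fun ξ hξ => ?_
      · refine DifferentiableOn.diffContOnCl fun ξ hξ => ?_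
        rw [closure_ball _ hR2.ne'] at hξ
        exact (hder ξ (hRS (hsub hξ)) x).differentiableAt.differentiableWithinAt
      · have hξ' := hsub (Metric.sphere_subset_closedBall hξ)
        refine hbound _ ξ (hRS hξ') ?_ x
        have := norm_le_of_mem_closedBall hξ'
        exact this
    · exact (((integrable_exp_neg_mul_sum_abs hε).const_mul _).div_const _)
    · refine Filter.Eventually.of_forall fun x ζ hζ => hder ζ (hRS ?_) x
      exact Metric.ball_subset_closedBall (Metric.ball_subset_ball (by linarith) hζ)
  have htrans : ∀ ζ (r : ℝ), ∫ x, G (p (ζ + r) x) = ∫ x, G (p ζ x) := by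
    intro ζ r
    rw [← integral_add_right_eq_self (fun x => G (p ζ x)) (r • v)]
    congr 1
    funext x
    congr 1
    funext k
    simp [hp, hvc]
    ring
  -- Real shifts of `ζ` are absorbed by translation invariance of Lebesgue measure; the derivative
  -- along the real direction vanishes, hence so does the complex derivative.
  have hH0 : ∀ ζ ∈ S, HasDerivAt (fun ζ => ∫ x, G (p ζ x)) 0 ζ := by
    intro ζ hζ
    have h1 := hH ζ hζ
    have h2 : HasDerivAt (fun y : ℂ => ∫ x, G (p (ζ + y) x)) (∫ x, fderiv ℂ G (p ζ x) vc)
        ((0 : ℝ) : ℂ) := by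
      refine HasDerivAt.comp_const_add (f := fun ζ => ∫ x, G (p ζ x)) ζ _ ?_
      rw [Complex.ofReal_zero, add_zero]
      exact h1
    have h3 := h2.comp_ofReal
    simp only [htrans] at h3
    rwa [h3.unique (hasDerivAt_const (0 : ℝ) _)] at h1
  have hfin := hSo.is_const_of_deriv_eq_zero (𝕜 := ℂ) hSc.isPreconnected
    (fun ζ hζ => (hH0 ζ hζ).differentiableAt.differentiableWithinAt)
    (fun ζ hζ => (hH0 ζ hζ).deriv) (x := 0) (y := Complex.I)
    (by simpa [hS] using hθ) (by simpa [hS, hv] using hθ')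
  have e1 : ∀ x : Fin n → ℝ, p 0 x = fun k => (x k : ℂ) + Complex.I * (θ k : ℂ) := by
    intro x; simp [hp]
  have e2 : ∀ x : Fin n → ℝ, p Complex.I x = fun k => (x k : ℂ) + Complex.I * (θ' k : ℂ) := by
    intro x; funext k; simp [hp, hvc, hv]; ring
  simpa only [e1, e2] using hfin

/-! ### Fourier inversion -/

open FourierTransform in
/-- Fourier inversion on `ℝⁿ`, without `2π` in the exponent. -/
theorem integral_exp_mul_integral_exp_mul {n : ℕ} {G : (Fin n → ℝ) → ℂ} (hc : Continuous G)
    (hi : Integrable G)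
    (hF : Integrable fun t : Fin n → ℝ =>
      ∫ x : Fin n → ℝ, Complex.exp (Complex.I * ∑ k, (t k : ℂ) * x k) * G x)
    (y : Fin n → ℝ) :
    ∫ t : Fin n → ℝ, Complex.exp (-(Complex.I * ∑ k, (t k : ℂ) * y k)) *
      ∫ x : Fin n → ℝ, Complex.exp (Complex.I * ∑ k, (t k : ℂ) * x k) * G x =
    (2 * (Real.pi : ℂ)) ^ n * G y := by
  set Gh : (Fin n → ℝ) → ℂ := fun t =>
    ∫ x : Fin n → ℝ, Complex.exp (Complex.I * ∑ k, (t k : ℂ) * x k) * G x with hGh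
  set g : EuclideanSpace ℝ (Fin n) → ℂ := fun x => G x.ofLp with hg
  have hmp := PiLp.volume_preserving_ofLp (Fin n)
  have hme : MeasurableEmbedding (WithLp.ofLp : EuclideanSpace ℝ (Fin n) → Fin n → ℝ) :=
    (MeasurableEquiv.toLp 2 (Fin n → ℝ)).symm.measurableEmbedding
  have hgc : Continuous g := hc.comp (PiLp.continuous_ofLp 2 _)
  have hgi : Integrable g := (hmp.integrable_comp_emb hme).2 hi
  -- The substitution `t = -2πw` matches the two conventions; its Jacobian produces `(2π)ⁿ`.
  have hfour : ∀ w : EuclideanSpace ℝ (Fin n), 𝓕 g w = Gh ((-2 * Real.pi) • w.ofLp) := by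
    intro w
    rw [Real.fourier_eq', hGh]
    simp only
    rw [← hmp.integral_comp hme]
    congr 1
    funext x
    rw [smul_eq_mul]
    congr 2
    simp only [PiLp.inner_apply, Pi.smul_apply, smul_eq_mul, RCLike.inner_apply, conj_trivial]
    push_cast
    simp only [Finset.mul_sum, Finset.sum_mul]
    refine Finset.sum_congr rfl fun k _ => ?_
    ring
  have hpi : (-2 * Real.pi) ≠ 0 := by
    have := Real.pi_pos
    intro h; linarith
  have hfi : Integrable (𝓕 g) := by
    rw [show 𝓕 g = (fun t => Gh ((-2 * Real.pi) • t)) ∘ WithLp.ofLp from funext hfour]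
    exact (hmp.integrable_comp_emb hme).2 (hF.comp_smul hpi)
  have hinv := hgi.fourierInv_fourier_eq hfi (v := WithLp.toLp 2 y) hgc.continuousAt
  rw [Real.fourierInv_eq'] at hinv
  have h1 : ∫ t : Fin n → ℝ, Complex.exp (-(Complex.I *
      ∑ k, ((((-2 * Real.pi) • t) k : ℝ) : ℂ) * y k)) * Gh ((-2 * Real.pi) • t) = G y := by
    rw [← hmp.integral_comp hme]
    refine Eq.trans ?_ hinv
    congr 1
    funext w
    rw [hfour, smul_eq_mul]
    congr 2
    simp only [PiLp.inner_apply, Pi.smul_apply, smul_eq_mul, RCLike.inner_apply, conj_trivial]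
    push_cast
    simp only [Finset.mul_sum, Finset.sum_mul, ← Finset.sum_neg_distrib]
    refine Finset.sum_congr rfl fun k _ => ?_
    ring
  rw [Measure.integral_comp_smul volume (fun t : Fin n → ℝ =>
    Complex.exp (-(Complex.I * ∑ k, ((t k : ℝ) : ℂ) * y k)) * Gh t)] at h1
  rw [← h1, Module.finrank_fin_fun, abs_inv, abs_pow, abs_mul, abs_neg, abs_two,
    abs_of_pos Real.pi_pos, Complex.real_smul]
  push_cast
  rw [← mul_assoc, mul_inv_cancel₀, one_mul]
  have : (Real.pi : ℂ) ≠ 0 := by exact_mod_cast Real.pi_pos.ne'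
  exact pow_ne_zero _ (mul_ne_zero two_ne_zero this)

/-! ### Laurent polynomials in logarithmic coordinates -/

namespace LaurentPoly

variable {n : ℕ}

theorem eval_exp (f : LaurentPoly n) (w : Fin n → ℂ) :
    f.eval (fun k => Complex.exp (w k)) =
      ∑ α ∈ f.coeff.support, f.coeff α * Complex.exp (∑ k, (α k : ℂ) * w k) := by
  refine Finset.sum_congr rfl fun α _ => ?_
  rw [Complex.exp_sum]
  congr 1
  exact Finset.prod_congr rfl fun k _ => (Complex.exp_int_mul _ _).symm

theorem differentiable_eval_exp (f : LaurentPoly n) :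
    Differentiable ℂ fun w : Fin n → ℂ => f.eval (fun k => Complex.exp (w k)) := by
  simp only [eval_exp]
  fun_prop

end LaurentPoly

theorem isArg_exp {n : ℕ} (w : Fin n → ℂ) :
    IsArg (fun k => Complex.exp (w k)) (fun k => (w k).im) := by
  refine fun k => ⟨Complex.exp_ne_zero _, ?_⟩
  rw [Complex.norm_exp, Complex.ofReal_exp, ← Complex.exp_add, mul_comm Complex.I,
    Complex.re_add_im]

theorem IsArg.eq_exp {n : ℕ} {z : Fin n → ℂ} {φ : Fin n → ℝ} (h : IsArg z φ) :
    z = fun k => Complex.exp ((Real.log ‖z k‖ : ℂ) + Complex.I * (φ k : ℂ)) := by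
  funext k
  rw [Complex.exp_add, ← Complex.ofReal_exp, Real.exp_log (norm_pos_iff.2 (h k).1)]
  exact (h k).2

/-- Some direction separates finitely many points of the integer lattice. -/
theorem exists_injective_sum_mul {n : ℕ} (A : Finset (Fin n → ℤ)) :
    ∃ v : Fin n → ℝ, Function.Injective fun α : A => ∑ k, (α.1 k : ℝ) * v k := by
  -- Some functional is nonzero on each of the finitely many nonzero differences `α - β`.
  obtain ⟨g, hg⟩ := Module.exists_dual_forall_apply_ne_zero (K := ℝ)
    (ι := {p : A × A // p.1 ≠ p.2}) (M := Fin n → ℝ)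
    (fun p k => ((p.1.1.1 k : ℝ) - (p.1.2.1 k : ℝ))) (by
      intro p h
      apply p.2
      ext k
      have := congrFun h k
      simp only [Pi.zero_apply, sub_eq_zero] at this
      exact_mod_cast this)
  refine ⟨fun k => g (fun j => if k = j then 1 else 0), fun α β hαβ => ?_⟩
  by_contra hne
  apply hg ⟨(α, β), hne⟩
  rw [LinearMap.pi_apply_eq_sum_univ]
  simp only [smul_eq_mul, sub_mul, Finset.sum_sub_distrib]
  exact sub_eq_zero.2 hαβ

theorem sum_re_mul_re {n : ℕ} (s w : Fin n → ℂ) :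
    (∑ k, s k * w k).re = ∑ k, (s k).re * (w k).re - ∑ k, (s k).im * (w k).im := by
  rw [Complex.re_sum, ← Finset.sum_sub_distrib]
  simp only [Complex.mul_re]

namespace LaurentPoly

variable {n : ℕ}

theorem eval_exp_ne_zero {f : LaurentPoly n} {w : Fin n → ℂ}
    (h : (fun k => (w k).im) ∉ f.coamoeba) : f.eval (fun k => Complex.exp (w k)) ≠ 0 :=
  fun h0 => h ⟨_, h0, isArg_exp w⟩

/-- Away from the closure of the coamoeba, a Laurent polynomial is bounded below by all the
exponentials with exponents in its Newton polytope, locally uniformly in the argument. -/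
theorem exists_exp_le_mul_norm_eval {f : LaurentPoly n} {θ₀ : Fin n → ℝ}
    (hθ₀ : θ₀ ∉ closure f.coamoeba) :
    ∃ δ > 0, ∃ K ≥ 0, Metric.ball θ₀ δ ⊆ (closure f.coamoeba)ᶜ ∧
      ∀ w : Fin n → ℂ, (fun k => (w k).im) ∈ Metric.ball θ₀ δ → ∀ y ∈ f.newtonPolytope,
        Real.exp (∑ k, y k * (w k).re) ≤ K * ‖f.eval (fun k => Complex.exp (w k))‖ := by
  obtain ⟨δ', hδ', hsub⟩ := Metric.isOpen_iff.1 isClosed_closure.isOpen_compl θ₀ hθ₀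
  obtain ⟨v, hv⟩ := exists_injective_sum_mul f.coeff.support
  have hδ : 0 < δ' / 2 := by positivity
  -- Half of `δ'` is left for the motion `τ.im • v`; the `+ 1` covers `v = 0`.
  have hr : 0 < δ' / 2 / (‖v‖ + 1) := by positivity
  obtain ⟨c, hc, hcu⟩ := exists_mul_norm_le_norm_sum hv hr
  set D : ℝ := ∑ α : f.coeff.support, ‖f.coeff α.1‖⁻¹ with hD
  have hD0 : 0 ≤ D := Finset.sum_nonneg fun _ _ => by positivity
  refine ⟨δ' / 2, hδ, D / c, by positivity,
    (Metric.ball_subset_ball (by linarith)).trans hsub, fun w hw y hy => ?_⟩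
  set B := D / c * ‖f.eval (fun k => Complex.exp (w k))‖ with hB
  set u : f.coeff.support → ℂ := fun α =>
    f.coeff α.1 * Complex.exp (∑ k, (α.1 k : ℂ) * w k) with hu
  have hsumu : ∑ α, u α = f.eval (fun k => Complex.exp (w k)) := by
    rw [eval_exp]
    exact Finset.sum_coe_sort f.coeff.support fun α =>
      f.coeff α * Complex.exp (∑ k, (α k : ℂ) * w k)
  have hlow : c * ‖u‖ ≤ ‖f.eval (fun k => Complex.exp (w k))‖ := by
    rw [← hsumu]
    refine hcu u fun τ hτ => ?_
    have hw' : (fun k => (w k + τ * (v k : ℂ)).im) ∉ f.coamoeba := by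
      refine fun hmem => hsub ?_ (subset_closure hmem)
      have e : (fun k => (w k + τ * (v k : ℂ)).im) = (fun k => (w k).im) + τ.im • v := by
        funext k; simp
      rw [e, Metric.mem_ball, dist_eq_norm, add_sub_right_comm]
      have h1 : ‖(fun k => (w k).im) - θ₀‖ < δ' / 2 := by
        rw [← dist_eq_norm]; exact hw
      have h2 : ‖τ.im • v‖ ≤ δ' / 2 := by
        rw [norm_smul]
        have h3 : ‖τ.im‖ ≤ δ' / 2 / (‖v‖ + 1) := by
          rw [mem_ball_zero_iff] at hτ
          exact (Complex.abs_im_le_norm τ).trans hτ.le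
        calc ‖τ.im‖ * ‖v‖ ≤ δ' / 2 / (‖v‖ + 1) * (‖v‖ + 1) := by gcongr; linarith
          _ = δ' / 2 := div_mul_cancel₀ _ (by positivity)
      linarith [norm_add_le ((fun k => (w k).im) - θ₀) (τ.im • v)]
    have h := eval_exp_ne_zero hw'
    rw [eval_exp, ← Finset.sum_coe_sort] at h
    convert h using 2 with α
    rw [hu, mul_assoc, ← Complex.exp_add]
    congr 2
    push_cast
    rw [Finset.sum_mul, ← Finset.sum_add_distrib]
    refine Finset.sum_congr rfl fun k _ => ?_
    ring
  have hvert : ∀ α ∈ f.coeff.support, Real.exp (∑ k, (α k : ℝ) * (w k).re) ≤ B := by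
    intro α hα
    have ha : 0 < ‖f.coeff α‖ := norm_pos_iff.2 (Finsupp.mem_support_iff.1 hα)
    have h1 : ‖f.coeff α‖ * Real.exp (∑ k, (α k : ℝ) * (w k).re) ≤ ‖u‖ := by
      have := norm_le_pi_norm u ⟨α, hα⟩
      rw [hu, norm_mul, Complex.norm_exp, sum_re_mul_re] at this
      simpa using this
    have h2 : ‖f.coeff α‖⁻¹ ≤ D :=
      Finset.single_le_sum (f := fun α : f.coeff.support => ‖f.coeff α.1‖⁻¹)
        (fun _ _ => by positivity) (Finset.mem_univ ⟨α, hα⟩)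
    calc Real.exp (∑ k, (α k : ℝ) * (w k).re)
        = ‖f.coeff α‖⁻¹ * (‖f.coeff α‖ * Real.exp (∑ k, (α k : ℝ) * (w k).re)) := by
          rw [inv_mul_cancel_left₀ ha.ne']
      _ ≤ D * ‖u‖ := by gcongr
      _ = D / c * (c * ‖u‖) := by field_simp
      _ ≤ B := by rw [hB]; gcongr
  rcases f.coeff.support.eq_empty_or_nonempty with hE | ⟨α₀, hα₀⟩
  · simp [newtonPolytope, hE] at hy
  -- After taking logarithms the bound is affine in `y`, so it passes from the exponents to their
  -- convex hull.
  have hBpos : 0 < B := (Real.exp_pos _).trans_le (hvert α₀ hα₀)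
  rw [← Real.le_log_iff_exp_le hBpos]
  have hconv : Convex ℝ {y : Fin n → ℝ | ∑ k, y k * (w k).re ≤ Real.log B} :=
    convex_halfSpace_le ⟨fun a b => by simp [add_mul, Finset.sum_add_distrib],
      fun a b => by simp [mul_assoc, Finset.mul_sum]⟩ _
  refine convexHull_min ?_ hconv hy
  rintro _ ⟨α, hα, rfl⟩
  exact (Real.le_log_iff_exp_le hBpos).2 (hvert α hα)

/-! ### Decay of the Mellin kernel and independence of direction -/

/-- The directional Mellin integrand as a function on the complexification. -/
noncomputable def mellinKernel (f : LaurentPoly n) (s w : Fin n → ℂ) : ℂ :=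
  Complex.exp (∑ k, s k * w k) / f.eval (fun k => Complex.exp (w k))

theorem mellinIntegrand_eq (f : LaurentPoly n) (θ : Fin n → ℝ) (s : Fin n → ℂ)
    (x : Fin n → ℝ) : f.mellinIntegrand θ s x =
      f.mellinKernel s (fun k => (x k : ℂ) + Complex.I * (θ k : ℂ)) := rfl

theorem differentiableAt_mellinKernel {f : LaurentPoly n} (s : Fin n → ℂ) {w : Fin n → ℂ}
    (h : (fun k => (w k).im) ∉ f.coamoeba) : DifferentiableAt ℂ (f.mellinKernel s) w := by
  have h1 : DifferentiableAt ℂ (fun w : Fin n → ℂ => Complex.exp (∑ k, s k * w k)) w := by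
    fun_prop
  have h2 : f.mellinKernel s = fun w => Complex.exp (∑ k, s k * w k) *
      (f.eval (fun k => Complex.exp (w k)))⁻¹ := funext fun w => div_eq_mul_inv _ _
  rw [h2]
  exact h1.fun_mul (f.differentiable_eval_exp.differentiableAt.fun_inv (eval_exp_ne_zero h))

end LaurentPoly

/-- Since `⟨sign x, x⟩ = ∑ |x k|`, small shifts by sign vectors create exponential decay. They are
made both in the exponent `σ` and in the angle `φ`. -/
theorem norm_smul_sign_le {n : ℕ} {ε : ℝ} (hε : 0 ≤ ε) (x : Fin n → ℝ) :
    ‖fun k => ε * (SignType.sign (x k) : ℝ)‖ ≤ ε := by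
  refine (pi_norm_le_iff_of_nonneg hε).2 fun k => ?_
  rw [norm_mul, Real.norm_of_nonneg hε]
  refine mul_le_of_le_one_right hε ?_
  rcases lt_trichotomy (x k) 0 with h | h | h <;> simp [h]

namespace LaurentPoly

variable {n : ℕ}

/-- Exponential decay of the Mellin kernel on a tube over a neighbourhood of `θ₀`. -/
theorem exists_norm_mellinKernel_le {f : LaurentPoly n} {θ₀ : Fin n → ℝ}
    (hθ₀ : θ₀ ∉ closure f.coamoeba) {σ : Fin n → ℝ} (hσ : σ ∈ interior f.newtonPolytope) :
    ∃ δ > 0, ∃ ε > 0, ∃ K ≥ 0, Metric.ball θ₀ δ ⊆ (closure f.coamoeba)ᶜ ∧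
      ∀ s w : Fin n → ℂ, (fun k => (s k).re) = σ → (fun k => (w k).im) ∈ Metric.ball θ₀ δ →
        ‖f.mellinKernel s w‖ ≤
          K * Real.exp (-∑ k, (s k).im * (w k).im) * Real.exp (-ε * ∑ k, |(w k).re|) := by
  obtain ⟨δ, hδ, K, hK, hsub, hb⟩ := exists_exp_le_mul_norm_eval hθ₀
  obtain ⟨ε, hε, hεσ⟩ := Metric.nhds_basis_closedBall.mem_iff.1 (mem_interior_iff_mem_nhds.1 hσ)
  refine ⟨δ, hδ, ε, hε, K, hK, hsub, fun s w hs hw => ?_⟩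
  have hne : 0 < ‖f.eval (fun k => Complex.exp (w k))‖ :=
    norm_pos_iff.2 (eval_exp_ne_zero fun h => hsub hw (subset_closure h))
  have hy : (σ + fun k => ε * (SignType.sign (w k).re : ℝ)) ∈ f.newtonPolytope := by
    apply hεσ
    rw [Metric.mem_closedBall, dist_eq_norm, add_sub_cancel_left]
    exact norm_smul_sign_le hε.le _
  have h := hb w hw _ hy
  have e : ∑ k, (σ + fun k => ε * (SignType.sign (w k).re : ℝ)) k * (w k).re =
      ∑ k, σ k * (w k).re + ε * ∑ k, |(w k).re| := by
    rw [Finset.mul_sum, ← Finset.sum_add_distrib]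
    refine Finset.sum_congr rfl fun k _ => ?_
    rw [Pi.add_apply, add_mul, mul_assoc, sign_mul_self]
  rw [e, Real.exp_add] at h
  subst hs
  rw [mellinKernel, norm_div, Complex.norm_exp, sum_re_mul_re, div_le_iff₀ hne,
    sub_eq_add_neg, Real.exp_add, neg_mul, Real.exp_neg (ε * _)]
  have hpos := Real.exp_pos (ε * ∑ k, |(w k).re|)
  rw [← le_div_iff₀ hpos] at h
  calc _ ≤ K * ‖f.eval (fun k => Complex.exp (w k))‖ / Real.exp (ε * ∑ k, |(w k).re|) *
        Real.exp (-∑ k, (s k).im * (w k).im) := by gcongr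
    _ = _ := by ring

theorem continuous_mellinIntegrand {f : LaurentPoly n} {θ : Fin n → ℝ}
    (hθ : θ ∉ closure f.coamoeba) (s : Fin n → ℂ) : Continuous (f.mellinIntegrand θ s) := by
  refine continuous_iff_continuousAt.2 fun x => ?_
  have hp : Continuous fun (x : Fin n → ℝ) (k : Fin n) =>
    (x k : ℂ) + Complex.I * (θ k : ℂ) := by fun_prop
  refine ContinuousAt.comp (f := fun (x : Fin n → ℝ) (k : Fin n) =>
    (x k : ℂ) + Complex.I * (θ k : ℂ)) (g := f.mellinKernel s)
    (differentiableAt_mellinKernel s ?_).continuousAt hp.continuousAt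
  simpa using fun h => hθ (subset_closure h)

/-- Uniform exponential bounds for the directional Mellin integrand near `θ₀`. -/
theorem exists_norm_mellinIntegrand_le {f : LaurentPoly n} {θ₀ : Fin n → ℝ}
    (hθ₀ : θ₀ ∉ closure f.coamoeba) {σ : Fin n → ℝ} (hσ : σ ∈ interior f.newtonPolytope) :
    ∃ δ > 0, ∃ ε > 0, ∃ K ≥ 0, ∀ s : Fin n → ℂ, (fun k => (s k).re) = σ →
      ∀ θ ∈ Metric.ball θ₀ δ, (∀ x, ‖f.mellinIntegrand θ s x‖ ≤
        K * Real.exp (-∑ k, (s k).im * θ k) * Real.exp (-ε * ∑ k, |x k|)) ∧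
      Integrable (f.mellinIntegrand θ s) ∧
      f.directionalMellin θ₀ s = f.directionalMellin θ s := by
  obtain ⟨δ, hδ, ε, hε, K, hK, hsub, hb⟩ := exists_norm_mellinKernel_le hθ₀ hσ
  refine ⟨δ, hδ, ε, hε, K, hK, fun s hs θ hθ => ?_⟩
  have hbd : ∀ x, ‖f.mellinIntegrand θ s x‖ ≤
      K * Real.exp (-∑ k, (s k).im * θ k) * Real.exp (-ε * ∑ k, |x k|) := by
    intro x
    have := hb s (fun k => (x k : ℂ) + Complex.I * (θ k : ℂ)) hs (by simpa using hθ)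
    simpa [mellinIntegrand_eq] using this
  refine ⟨hbd, ((integrable_exp_neg_mul_sum_abs hε).const_mul _).mono'
    (continuous_mellinIntegrand (hsub hθ) s).aestronglyMeasurable
    (Filter.Eventually.of_forall hbd), ?_⟩
  unfold directionalMellin
  congr 1
  simp only [mellinIntegrand_eq]
  -- The constant absorbs `exp (-⟨Im s, Im w⟩)`, which is bounded on the ball for fixed `s`.
  refine integral_tube_eq (C := K * Real.exp (∑ k, |(s k).im| * (‖θ₀‖ + δ))) Metric.isOpen_ball
    (convex_ball θ₀ δ) hε (by positivity)
    (fun w hw => differentiableAt_mellinKernel s fun h => hsub hw (subset_closure h)) ?_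
    (Metric.mem_ball_self hδ) hθ
  intro w hw
  refine (hb s w hs hw).trans ?_
  gcongr
  rw [← Finset.sum_neg_distrib]
  refine Finset.sum_le_sum fun k _ => ?_
  have h1 : |(w k).im| ≤ ‖θ₀‖ + δ := by
    have h2 : ‖fun k => (w k).im‖ ≤ ‖θ₀‖ + δ :=
      norm_le_of_mem_closedBall (Metric.ball_subset_closedBall hw)
    exact (norm_le_pi_norm (fun k => (w k).im) k).trans h2
  calc -((s k).im * (w k).im) ≤ |(s k).im * (w k).im| := neg_le_abs _
    _ = |(s k).im| * |(w k).im| := abs_mul _ _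
    _ ≤ _ := by gcongr

theorem IsCoamoebaComplementComponent.notMem {f : LaurentPoly n} {E : Set (Fin n → ℝ)}
    (hE : f.IsCoamoebaComplementComponent E) {θ : Fin n → ℝ} (hθ : θ ∈ E) :
    θ ∉ closure f.coamoeba := by
  obtain ⟨θ₀, -, rfl⟩ := hE
  exact connectedComponentIn_subset _ _ hθ

theorem IsCoamoebaComplementComponent.directionalMellin_eq {f : LaurentPoly n}
    {E : Set (Fin n → ℝ)} (hE : f.IsCoamoebaComplementComponent E) {θ θ' : Fin n → ℝ}
    (hθ : θ ∈ E) (hθ' : θ' ∈ E) {s : Fin n → ℂ}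
    (hs : (fun k => (s k).re) ∈ interior f.newtonPolytope) :
    f.directionalMellin θ s = f.directionalMellin θ' s := by
  have hpre : IsPreconnected E := by
    obtain ⟨θ₀, -, rfl⟩ := hE
    exact isPreconnected_connectedComponentIn
  refine hpre.induction₂ (fun a b => f.directionalMellin a s = f.directionalMellin b s)
    (fun a ha => ?_) (fun a b c _ _ _ => Eq.trans) (fun a b _ _ => Eq.symm) hθ hθ'
  obtain ⟨δ, hδ, ε, hε, K, hK, h⟩ := exists_norm_mellinIntegrand_le (hE.notMem ha) hs
  filter_upwards [mem_nhdsWithin_of_mem_nhds (Metric.ball_mem_nhds a hδ)] with b hb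
  exact (h s rfl b hb).2.2

/-! ### Vertical planes and inversion -/

theorem mellinIntegrand_verticalPoint (f : LaurentPoly n) (φ σ t x : Fin n → ℝ) :
    f.mellinIntegrand φ (verticalPoint σ t) x = Complex.exp (-∑ k, (t k : ℂ) * φ k) *
      (Complex.exp (Complex.I * ∑ k, (t k : ℂ) * x k) *
        f.mellinIntegrand φ (fun k => (σ k : ℂ)) x) := by
  simp only [mellinIntegrand, ← mul_div_assoc, ← Complex.exp_add]
  congr 2
  simp only [Finset.mul_sum, ← Finset.sum_neg_distrib, ← Finset.sum_add_distrib]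
  refine Finset.sum_congr rfl fun k _ => ?_
  simp only [verticalPoint]
  linear_combination ((t k : ℂ) * φ k) * Complex.I_sq

/-- The directional Mellin transform decays exponentially on vertical planes. -/
theorem integrable_fourier_mellinIntegrand {f : LaurentPoly n} {φ : Fin n → ℝ}
    (hφ : φ ∉ closure f.coamoeba) {σ : Fin n → ℝ} (hσ : σ ∈ interior f.newtonPolytope) :
    Integrable fun t : Fin n → ℝ => ∫ x : Fin n → ℝ,
      Complex.exp (Complex.I * ∑ k, (t k : ℂ) * x k) *
        f.mellinIntegrand φ (fun k => (σ k : ℂ)) x := by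
  obtain ⟨δ, hδ, ε, hε, K, hK, h⟩ := exists_norm_mellinIntegrand_le hφ hσ
  have hre : ∀ t, (fun k => (verticalPoint σ t k).re) = σ := by
    intro t; funext k; simp [verticalPoint]
  have hint := (h (fun k => (σ k : ℂ)) (by simp) φ (Metric.mem_ball_self hδ)).2.1
  have hcont := continuous_mellinIntegrand hφ (fun k => (σ k : ℂ))
  have hnorm : ∀ t x : Fin n → ℝ, ‖Complex.exp (Complex.I * ∑ k, (t k : ℂ) * x k)‖ = 1 := by
    intro t x
    rw [mul_comm, show (∑ k, (t k : ℂ) * x k) = ((∑ k, t k * x k : ℝ) : ℂ) by push_cast; rfl]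
    exact Complex.norm_exp_ofReal_mul_I _
  refine ((integrable_exp_neg_mul_sum_abs (half_pos hδ)).const_mul
    (K * ∫ x : Fin n → ℝ, Real.exp (-ε * ∑ k, |x k|))).mono' ?_
    (Filter.Eventually.of_forall fun t => ?_)
  · refine (continuous_of_dominated (bound := fun x =>
      ‖f.mellinIntegrand φ (fun k => (σ k : ℂ)) x‖) (fun t => ?_) (fun t => ?_) hint.norm
      ?_).aestronglyMeasurable
    · exact Continuous.aestronglyMeasurable (by fun_prop)
    · refine Filter.Eventually.of_forall fun x => ?_
      rw [norm_mul, hnorm, one_mul]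
    · refine Filter.Eventually.of_forall fun x => ?_
      fun_prop
  -- The angle may depend on `t`: moving from `φ` to `φ + η` leaves the integral unchanged but
  -- improves the bound by `exp (-(δ / 2) ∑ |t k|)`.
  · set η : Fin n → ℝ := fun k => δ / 2 * (SignType.sign (t k) : ℝ) with hη
    have hmem : φ + η ∈ Metric.ball φ δ := by
      rw [Metric.mem_ball, dist_eq_norm, add_sub_cancel_left]
      exact (norm_smul_sign_le (half_pos hδ).le t).trans_lt (half_lt_self hδ)
    obtain ⟨hb, -, heq⟩ := h (verticalPoint σ t) (hre t) (φ + η) hmem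
    have hpi : (1 / (2 * (Real.pi : ℂ) * Complex.I) ^ n) ≠ 0 :=
      one_div_ne_zero (pow_ne_zero _ (mul_ne_zero (mul_ne_zero two_ne_zero
        (Complex.ofReal_ne_zero.2 Real.pi_ne_zero)) Complex.I_ne_zero))
    have heq' := mul_left_cancel₀ hpi heq
    simp only [mellinIntegrand_verticalPoint f φ, integral_const_mul] at heq'
    have h1 := norm_integral_le_of_norm_le
      ((integrable_exp_neg_mul_sum_abs hε).const_mul _) (Filter.Eventually.of_forall hb)
    rw [← heq', norm_mul, integral_const_mul, Complex.norm_exp] at h1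
    have e1 : (-∑ k, (t k : ℂ) * φ k).re = -∑ k, t k * φ k := by
      simp
    have e2 : ∑ k, (verticalPoint σ t k).im * (φ + η) k =
        ∑ k, t k * φ k + δ / 2 * ∑ k, |t k| := by
      rw [Finset.mul_sum, ← Finset.sum_add_distrib]
      refine Finset.sum_congr rfl fun k _ => ?_
      have : (verticalPoint σ t k).im = t k := by simp [verticalPoint]
      rw [this, Pi.add_apply, mul_add, hη]
      simp only
      rw [mul_left_comm, self_mul_sign]
    rw [e1, e2, neg_add, Real.exp_add] at h1
    refine le_of_mul_le_mul_left (h1.trans_eq ?_) (Real.exp_pos (-∑ k, t k * φ k))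
    rw [neg_mul]
    ring

/-- The growth `exp ⟨t, φ⟩` of `z^{-s}` cancels the factor `exp (-⟨t, φ⟩)` of the transform, leaving
an inverse Fourier integrand at `log |z|`. -/
theorem directionalMellin_mul_cpowBranch (f : LaurentPoly n) (φ σ t : Fin n → ℝ)
    (z : Fin n → ℂ) :
    f.directionalMellin φ (verticalPoint σ t) * cpowBranch φ z (-verticalPoint σ t) =
      1 / (2 * (Real.pi : ℂ) * Complex.I) ^ n *
        Complex.exp (-∑ k, (σ k : ℂ) * ((Real.log ‖z k‖ : ℂ) + Complex.I * (φ k : ℂ))) *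
        (Complex.exp (-(Complex.I * ∑ k, (t k : ℂ) * (Real.log ‖z k‖ : ℂ))) *
          ∫ x : Fin n → ℝ, Complex.exp (Complex.I * ∑ k, (t k : ℂ) * x k) *
            f.mellinIntegrand φ (fun k => (σ k : ℂ)) x) := by
  have e : Complex.exp (-∑ k, (t k : ℂ) * φ k) * cpowBranch φ z (-verticalPoint σ t) =
      Complex.exp (-∑ k, (σ k : ℂ) * ((Real.log ‖z k‖ : ℂ) + Complex.I * (φ k : ℂ))) *
        Complex.exp (-(Complex.I * ∑ k, (t k : ℂ) * (Real.log ‖z k‖ : ℂ))) := by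
    rw [cpowBranch, ← Complex.exp_add, ← Complex.exp_add]
    congr 1
    simp only [Finset.mul_sum, ← Finset.sum_neg_distrib, ← Finset.sum_add_distrib]
    refine Finset.sum_congr rfl fun k _ => ?_
    simp only [verticalPoint, Pi.neg_apply]
    linear_combination (-(t k : ℂ) * φ k) * Complex.I_sq
  simp only [directionalMellin, mellinIntegrand_verticalPoint f φ, integral_const_mul]
  linear_combination (1 / (2 * (Real.pi : ℂ) * Complex.I) ^ n *
    ∫ x : Fin n → ℝ, Complex.exp (Complex.I * ∑ k, (t k : ℂ) * x k) *
      f.mellinIntegrand φ (fun k => (σ k : ℂ)) x) * e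

end LaurentPoly

theorem theorem6 {n : ℕ} (f : LaurentPoly n) (E : Set (Fin n → ℝ))
    (hE : f.IsCoamoebaComplementComponent E) :
    -- the directional Mellin integral converges for every direction in `E`
    (∀ θ ∈ E, ∀ s : Fin n → ℂ, (fun k => (s k).re) ∈ interior f.newtonPolytope →
      MeasureTheory.Integrable (f.mellinIntegrand θ s) MeasureTheory.volume) ∧
    -- and does not depend on the direction in `E`
    (∀ θ ∈ E, ∀ θ' ∈ E, ∀ s : Fin n → ℂ, (fun k => (s k).re) ∈ interior f.newtonPolytope →
      f.directionalMellin θ s = f.directionalMellin θ' s) ∧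
    -- inversion formula, `φ` being the value of the argument of `z` that lies in `E`
    (∀ θ ∈ E, ∀ σ ∈ interior f.newtonPolytope, ∀ z : Fin n → ℂ, ∀ φ ∈ E, IsArg z φ →
      f.eval z ≠ 0 ∧
      VerticalIntegrable (fun s => f.directionalMellin θ s * cpowBranch φ z (-s)) σ ∧
      1 / f.eval z =
        verticalIntegral (fun s => f.directionalMellin θ s * cpowBranch φ z (-s)) σ) := by
  have hint : ∀ θ ∈ E, ∀ s : Fin n → ℂ, (fun k => (s k).re) ∈ interior f.newtonPolytope →
      Integrable (f.mellinIntegrand θ s) := by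
    intro θ hθ s hs
    obtain ⟨δ, hδ, ε, -, K, -, h⟩ :=
      LaurentPoly.exists_norm_mellinIntegrand_le (hE.notMem hθ) hs
    exact (h s rfl θ (Metric.mem_ball_self hδ)).2.1
  refine ⟨hint, fun θ hθ θ' hθ' s hs => hE.directionalMellin_eq hθ hθ' hs,
    fun θ hθ σ hσ z φ hφ hz => ?_⟩
  have hφc := hE.notMem hφ
  have hf := LaurentPoly.integrable_fourier_mellinIntegrand hφc hσ
  -- The direction `θ` is replaced by the argument `φ` of `z`, which makes this cancellation
  -- possible.
  have heq : (fun t : Fin n → ℝ => f.directionalMellin θ (verticalPoint σ t) *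
      cpowBranch φ z (-verticalPoint σ t)) = _ := funext fun t => by
    rw [hE.directionalMellin_eq hθ hφ (by simpa [verticalPoint] using hσ),
      LaurentPoly.directionalMellin_mul_cpowBranch]
  refine ⟨fun h0 => hφc (subset_closure ⟨z, h0, hz⟩), ?_, ?_⟩
  · rw [VerticalIntegrable, heq]
    refine Integrable.const_mul (hf.bdd_mul (c := 1)
      (Continuous.aestronglyMeasurable (by fun_prop)) (Filter.Eventually.of_forall fun t => ?_)) _
    rw [show -(Complex.I * ∑ k, (t k : ℂ) * (Real.log ‖z k‖ : ℂ)) =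
      ((-∑ k, t k * Real.log ‖z k‖ : ℝ) : ℂ) * Complex.I by push_cast; ring,
      Complex.norm_exp_ofReal_mul_I]
  -- At `x = log |z|` the integrand is `z^σ / f(z)`, and `iⁿ (2π)ⁿ` cancels the normalization.
  · rw [verticalIntegral, heq, integral_const_mul,
      integral_exp_mul_integral_exp_mul (LaurentPoly.continuous_mellinIntegrand hφc _)
        (hint φ hφ _ (by simpa using hσ)) hf, LaurentPoly.mellinIntegrand, ← hz.eq_exp,
      Complex.exp_neg, mul_pow]
    have h1 := Complex.exp_ne_zero
      (∑ k, (σ k : ℂ) * ((Real.log ‖z k‖ : ℂ) + Complex.I * (φ k : ℂ)))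
    have h2 : (2 * (Real.pi : ℂ)) ^ n ≠ 0 := pow_ne_zero _
      (mul_ne_zero two_ne_zero (Complex.ofReal_ne_zero.2 Real.pi_ne_zero))
    have h3 : Complex.I ^ n ≠ 0 := pow_ne_zero _ Complex.I_ne_zero
    field_simp
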